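/- A \emph{weighted graph} on vertices $1,\dots,n$ is a family of weights $\alpha_{ij}=\alpha_{ji}\ge 0$, $1\le i\ne j\le n$ (connectedness is not assumed). Its random-walk Laplacian is the $n\times n$ matrix with entries $-\alpha_{ij}$ for $i\ne j$ and diagonal entries $\sum_{k\ne i}\alpha_{ik}$. Its interchange Laplacian is the $n!\times n!$ matrix indexed by permutations $\sigma,\sigma'\in\mathcal S_n$ whose $(\sigma,\sigma')$ entry is $-\alpha_{ij}$ if $\sigma'=(ij)\sigma$ with $i<j$, $\sum_{i<j}\alpha_{ij}$ if $\sigma=\sigma'$, and $0$ otherwise. For $n\ge 2$, the spectral gap of the random walk (respectively, of the interchange process) is the second smallest eigenvalue, counted with multiplicity, of the corresponding Laplacian. \emph{Aldous' conjecture holds} for the weighted graph if these two spectral gaps are equal; for fewer than two vertices it is regarded as vacuously true. For $k\ge 2$, say that the Dirichlet-form inequality $C_k$ holds if for every function $g:\mathcal S_k\to\mathbb R$ and all $\gamma_1,\dots,\gamma_{k-1}\ge 0$, $$\sum_{\sigma\in\mathcal S_k}\sum_{i=1}^{k-1}\gamma_i\,[g(\sigma)-g((ik)\sigma)]^2\;\ge\;\sum_{\sigma\in\mathcal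 S_k}\ \sum_{1\le i<j\le k-1}\frac{\gamma_i\gamma_j}{\gamma_1+\dots+\gamma_{k-1}}\,[g(\sigma)-g((ij)\sigma)]^2 ,$$ where the right-hand side is read as $0$ if all $\gamma_i$ vanish. (a) Let $K$ be a natural number, and suppose that $C_k$ holds for all $2\le k\le K$. Let $\alpha$ be a weighted graph on $n\ge 1$ vertices such that at most $K-1$ of the weights $\alpha_{1n},\dots,\alpha_{n-1,n}$ are strictly positive. If Aldous' conjecture holds for the weighted graph on the vertices $1,\dots,n-1$ with weights $$\alpha'_{ij}=\alpha_{ij}+\frac{\alpha_{in}\alpha_{jn}}{\sum_{l=1}^{n-1}\alpha_{ln}}\qquad(1\le i\ne j\le n-1)$$ (with $\alpha'_{ij}=\alpha_{ij}$ if the denominator vanishes), then Aldous' conjecture holds for $\alpha$. (b) If $C_k$ holds for all $k\ge 2$, then Aldous' conjecture holds for every weighted graph. -/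

import Mathlib

open scoped BigOperators

noncomputable section

/-- A weighted undirected graph on the vertices `0, …, n - 1`: a nonnegative weight for each
unordered pair of distinct vertices, zero meaning that there is no edge.
No connectedness is assumed. -/
@[ext]
structure WeightedGraph (n : ℕ) where
  weight : Fin n → Fin n → ℝ
  symm : ∀ i j, weight i j = weight j i
  loopless : ∀ i, weight i i = 0
  nonneg : ∀ i j, 0 ≤ weight i j

/-- The second smallest eigenvalue, counted with multiplicity, of a real symmetric matrix of
size at least two (`eigenvalues₀` lists the eigenvalues, with multiplicity, in decreasing
order). -/
def secondSmallestEigenvalue {ι : Type*} [Fintype ι] [DecidableEq ι] {A : Matrix ι ι ℝ}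
    (hA : A.IsHermitian) (h : 2 ≤ Fintype.card ι) : ℝ :=
  hA.eigenvalues₀ ⟨Fintype.card ι - 2, by omega⟩

theorem two_le_card_perm_fin {n : ℕ} (h : 2 ≤ n) :
    2 ≤ Fintype.card (Equiv.Perm (Fin n)) := by
  rw [Fintype.card_perm, Fintype.card_fin]
  exact h.trans (Nat.self_le_factorial n)

namespace WeightedGraph

variable {n : ℕ}

/-- The Laplacian of the random-walk process (the negative of its intensity matrix). -/
def rwLaplacian (G : WeightedGraph n) : Matrix (Fin n) (Fin n) ℝ :=
  Matrix.of fun i j => if i = j then ∑ k, G.weight j k else -G.weight i j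

/-- The Laplacian of the interchange process (the negative of its intensity matrix), indexed
by permutations: the `(σ, τ)` entry is `-α i j` if `τ = (i j) σ`, the total weight of all
edges if `σ = τ`, and zero otherwise. -/
def interchangeLaplacian (G : WeightedGraph n) :
    Matrix (Equiv.Perm (Fin n)) (Equiv.Perm (Fin n)) ℝ :=
  Matrix.of fun σ τ =>
    if σ = τ then ∑ p : Fin n × Fin n with p.1 < p.2, G.weight p.1 p.2
    else -∑ p : Fin n × Fin n with p.1 < p.2 ∧ τ = Equiv.swap p.1 p.2 * σ, G.weight p.1 p.2

theorem rwLaplacian_isHermitian (G : WeightedGraph n) : G.rwLaplacian.IsHermitian := by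
  ext i j
  by_cases h : i = j
  · subst h; simp [rwLaplacian]
  · simp [rwLaplacian, h, Ne.symm h, G.symm i j]

theorem interchangeLaplacian_isHermitian (G : WeightedGraph n) :
    G.interchangeLaplacian.IsHermitian := by
  ext σ τ
  by_cases h : σ = τ
  · subst h; simp [interchangeLaplacian]
  · have key : ∀ p : Fin n × Fin n,
        (σ = Equiv.swap p.1 p.2 * τ) ↔ (τ = Equiv.swap p.1 p.2 * σ) := by
      intro p
      constructor <;> rintro rfl <;> simp
    simp [interchangeLaplacian, h, Ne.symm h, key]

/-- The spectral gap of the random-walk process. -/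
def rwSpectralGap (G : WeightedGraph n) (h : 2 ≤ n) : ℝ :=
  secondSmallestEigenvalue G.rwLaplacian_isHermitian (by simpa using h)

/-- The spectral gap of the interchange process. -/
def interchangeSpectralGap (G : WeightedGraph n) (h : 2 ≤ n) : ℝ :=
  secondSmallestEigenvalue G.interchangeLaplacian_isHermitian (two_le_card_perm_fin h)

/-- Aldous' conjecture for the weighted graph `G`: the interchange process and the random-walk
process have the same spectral gap. (With fewer than two vertices there is no spectral gap
and nothing is claimed.) -/
def AldousHolds (G : WeightedGraph n) : Prop :=
  ∀ h : 2 ≤ n, G.interchangeSpectralGap h = G.rwSpectralGap h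

/-- The graph obtained by removing the last vertex `v` and updating the weights to
`α i j + α i v * α j v / ∑ l, α l v` for `i ≠ j`. If the last vertex is isolated then the
quotient is `0 / 0 = 0`, so the weights are unchanged. -/
def removeLast (G : WeightedGraph (n + 1)) : WeightedGraph n where
  weight i j :=
    if i = j then 0
    else G.weight i.castSucc j.castSucc +
      G.weight i.castSucc (Fin.last n) * G.weight j.castSucc (Fin.last n) /
        ∑ l : Fin n, G.weight l.castSucc (Fin.last n)
  symm i j := by
    by_cases h : i = j
    · subst h; rfl
    · simp only [h, Ne.symm h, if_false]
      rw [G.symm i.castSucc j.castSucc, mul_comm]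
  loopless i := by simp
  nonneg i j := by
    split_ifs
    · exact le_rfl
    · exact add_nonneg (G.nonneg _ _) (div_nonneg (mul_nonneg (G.nonneg _ _) (G.nonneg _ _))
        (Finset.sum_nonneg fun _ _ => G.nonneg _ _))

end WeightedGraph

/-- The conjectured inequality of Dirichlet forms on the symmetric group on `k = m + 1`
letters, where the last letter is the centre of the star. If all `γ i` vanish, the quotients
are `0 / 0 = 0` and both sides are zero. -/
def DirichletFormInequality (m : ℕ) : Prop :=
  ∀ (g : Equiv.Perm (Fin (m + 1)) → ℝ) (γ : Fin m → ℝ), (∀ i, 0 ≤ γ i) →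
    ∑ σ : Equiv.Perm (Fin (m + 1)), ∑ i : Fin m,
        γ i * (g σ - g (Equiv.swap i.castSucc (Fin.last m) * σ)) ^ 2 ≥
      ∑ σ : Equiv.Perm (Fin (m + 1)), ∑ p : Fin m × Fin m with p.1 < p.2,
        γ p.1 * γ p.2 / (∑ l, γ l) *
          (g σ - g (Equiv.swap p.1.castSucc p.2.castSucc * σ)) ^ 2

end

open scoped BigOperators

noncomputable section

/-! ### Variational description of the second smallest eigenvalue -/

namespace Matrix.IsHermitian

open Matrix

variable {ι : Type*} [Fintype ι] {A : Matrix ι ι ℝ}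

/-! Functions of one particle's position lift random-walk eigenvectors to the interchange process,
so the interchange gap is at most the random-walk gap. For the converse, take an eigenvector `f` for
the interchange gap, orthogonal to the constants, and sum out all particles but one.

If some marginal is nonzero, it is a random-walk eigenvector with the same eigenvalue and sum zero,
so the random-walk gap is no larger (`particleSum_interchangeLaplacian`).

If all marginals vanish, `f` has sum zero on each coset of the stabilizer of the last vertex. The
Poincaré inequality of the reduced graph on each coset bounds its gap times `f ⬝ᵥ f` by the reduced
energy, and the Dirichlet-form inequality bounds that by the full energy (`removeLast_energy_le`).
Hence the interchange gap does not increase under reduction. The random-walk gap does not decrease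
(`rwSpectralGap_le_removeLast`, by harmonic extension), and the two gaps of the reduced graph agree
by hypothesis. Part (b) is induction on the number of vertices. -/

theorem dotProduct_mulVec_comm (hA : A.IsHermitian) (x y : ι → ℝ) :
    x ⬝ᵥ A *ᵥ y = (A *ᵥ x) ⬝ᵥ y := by
  have h : Aᵀ = A := by simpa [Matrix.IsHermitian] using hA
  rw [dotProduct_mulVec, ← mulVec_transpose, h]

theorem dotProduct_one_eq_zero_of_eigenvalue_ne_zero (hA : A.IsHermitian) (hone : A *ᵥ 1 = 0)
    {c : ℝ} {x : ι → ℝ} (hx : A *ᵥ x = c • x) (hc : c ≠ 0) : x ⬝ᵥ 1 = 0 := by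
  have := hA.dotProduct_mulVec_comm x 1
  rw [hone, hx, dotProduct_zero, smul_dotProduct, smul_eq_mul] at this
  exact (mul_eq_zero.mp this.symm).resolve_left hc

variable [DecidableEq ι]

theorem exists_orthonormal_eigenvectors (hA : A.IsHermitian) :
    ∃ v : Fin (Fintype.card ι) → ι → ℝ,
      (∀ i j, v i ⬝ᵥ v j = if i = j then 1 else 0) ∧
      (∀ i, A *ᵥ v i = hA.eigenvalues₀ i • v i) ∧
      ∀ x y, x ⬝ᵥ y = ∑ i, (v i ⬝ᵥ x) * (v i ⬝ᵥ y) := by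
  -- The enumeration through which `eigenvalues` is defined from `eigenvalues₀`.
  let e : Fin (Fintype.card ι) ≃ ι := Fintype.equivOfCardEq (Fintype.card_fin _)
  have hinner : ∀ (x : EuclideanSpace ℝ ι) (y : EuclideanSpace ℝ ι),
      inner ℝ x y = (x : ι → ℝ) ⬝ᵥ (y : ι → ℝ) := by
    intro x y
    rw [EuclideanSpace.inner_eq_star_dotProduct, star_trivial, dotProduct_comm]
  refine ⟨fun i => ⇑(hA.eigenvectorBasis (e i)), fun i j => ?_, fun i => ?_, fun x y => ?_⟩
  · have := orthonormal_iff_ite.mp hA.eigenvectorBasis.orthonormal (e i) (e j)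
    rw [hinner] at this
    simpa using this
  · have := hA.mulVec_eigenvectorBasis (e i)
    simpa [Matrix.IsHermitian.eigenvalues, e] using this
  · have := hA.eigenvectorBasis.sum_inner_mul_inner (WithLp.toLp 2 x) (WithLp.toLp 2 y)
    simp only [hinner] at this
    rw [← e.sum_comp] at this
    rw [← this]
    exact Finset.sum_congr rfl fun i _ => by rw [dotProduct_comm x]

theorem eigenvalues₀_nonneg_of_form_nonneg (hA : A.IsHermitian)
    (hpos : ∀ x : ι → ℝ, 0 ≤ x ⬝ᵥ A *ᵥ x) (i : Fin (Fintype.card ι)) :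
    0 ≤ hA.eigenvalues₀ i := by
  obtain ⟨v, hv, hAv, -⟩ := hA.exists_orthonormal_eigenvectors
  simpa [hAv, hv] using hpos (v i)

/-- Otherwise all eigenvalues are positive, all eigenvectors are orthogonal to `1`, and Parseval
gives `1 ⬝ᵥ 1 = 0`. -/
theorem eigenvalues₀_last_eq_zero (hA : A.IsHermitian) (h : 0 < Fintype.card ι)
    (hpos : ∀ x : ι → ℝ, 0 ≤ x ⬝ᵥ A *ᵥ x) (hone : A *ᵥ 1 = 0) :
    hA.eigenvalues₀ ⟨Fintype.card ι - 1, by omega⟩ = 0 := by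
  obtain ⟨v, -, hAv, hsum⟩ := hA.exists_orthonormal_eigenvectors
  by_contra hne
  have hlt := lt_of_le_of_ne (hA.eigenvalues₀_nonneg_of_form_nonneg hpos _) (Ne.symm hne)
  have hzero : ∀ i, v i ⬝ᵥ 1 = 0 := fun i =>
    hA.dotProduct_one_eq_zero_of_eigenvalue_ne_zero hone (hAv i)
      (hlt.trans_le (hA.eigenvalues₀_antitone (Fin.le_def.mpr (Nat.le_sub_one_of_lt i.2)))).ne'
  have := hsum 1 1
  simp only [hzero, mul_zero, Finset.sum_const_zero] at this
  simp at this
  omega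

/-- The second smallest eigenvalue of a nonnegative matrix annihilating the constants has an
eigenvector orthogonal to the constants. -/
theorem exists_secondSmallest_eigenvector (hA : A.IsHermitian) (h : 2 ≤ Fintype.card ι)
    (hpos : ∀ x : ι → ℝ, 0 ≤ x ⬝ᵥ A *ᵥ x) (hone : A *ᵥ 1 = 0) :
    ∃ x : ι → ℝ, x ≠ 0 ∧ ∑ i, x i = 0 ∧ A *ᵥ x = secondSmallestEigenvalue hA h • x := by
  obtain ⟨v, hv, hAv, -⟩ := hA.exists_orthonormal_eigenvectors
  have hne : ∀ i, v i ≠ 0 := fun i h0 => by simpa [h0] using hv i i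
  have hsum : ∀ x : ι → ℝ, ∑ i, x i = x ⬝ᵥ 1 := fun x => (dotProduct_one x).symm
  simp only [hsum, secondSmallestEigenvalue]
  set k : Fin (Fintype.card ι) := ⟨Fintype.card ι - 2, by omega⟩
  set l : Fin (Fintype.card ι) := ⟨Fintype.card ι - 1, by omega⟩ with hl
  by_cases hk : v k ⬝ᵥ 1 = 0
  · exact ⟨v k, hne k, hk, hAv k⟩
  have hk0 : hA.eigenvalues₀ k = 0 := by
    by_contra hc
    exact hk (hA.dotProduct_one_eq_zero_of_eigenvalue_ne_zero hone (hAv k) hc)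
  have hl0 : hA.eigenvalues₀ l = 0 := hA.eigenvalues₀_last_eq_zero (by omega) hpos hone
  have hkl : k ≠ l := by simp [k, l, Fin.ext_iff]; omega
  -- Both eigenvalues vanish here, so the kernel contains a combination of `v k` and `v l`
  -- orthogonal to `1`.
  refine ⟨(v k ⬝ᵥ 1) • v l - (v l ⬝ᵥ 1) • v k, fun h0 => ?_, ?_, ?_⟩
  · have := congrArg (v l ⬝ᵥ ·) h0
    simp [dotProduct_sub, hv, hkl.symm] at this
    exact hk (by simpa using this)
  · simp only [sub_dotProduct, smul_dotProduct, smul_eq_mul]; ring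
  · rw [mulVec_sub, mulVec_smul, mulVec_smul, hAv, hAv, hk0, hl0]; simp

/-- On vectors orthogonal to the constants, the quadratic form of a nonnegative matrix
annihilating the constants is bounded below by the second smallest eigenvalue. -/
theorem secondSmallestEigenvalue_mul_le (hA : A.IsHermitian) (h : 2 ≤ Fintype.card ι)
    (hpos : ∀ x : ι → ℝ, 0 ≤ x ⬝ᵥ A *ᵥ x) (hone : A *ᵥ 1 = 0) {x : ι → ℝ}
    (hx : ∑ i, x i = 0) : secondSmallestEigenvalue hA h * (x ⬝ᵥ x) ≤ x ⬝ᵥ A *ᵥ x := by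
  obtain ⟨v, hv, hAv, hsum⟩ := hA.exists_orthonormal_eigenvectors
  rw [secondSmallestEigenvalue]
  set k : Fin (Fintype.card ι) := ⟨Fintype.card ι - 2, by omega⟩ with hkdef
  set l : Fin (Fintype.card ι) := ⟨Fintype.card ι - 1, by omega⟩ with hl
  rcases (hA.eigenvalues₀_nonneg_of_form_nonneg hpos k).eq_or_lt with hk | hk
  · rw [← hk, zero_mul]; exact hpos x
  have hle : ∀ i, i ≠ l → i ≤ k := fun i hi => by
    have := i.2
    simp only [hl, hkdef, ne_eq, Fin.ext_iff, Fin.le_def] at hi ⊢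
    omega
  -- With a positive gap, only `v l` can fail to be orthogonal to `1`. By Parseval `x` then has no
  -- `v l` component.
  have hone' : ∀ i, i ≠ l → v i ⬝ᵥ 1 = 0 := fun i hi =>
    hA.dotProduct_one_eq_zero_of_eigenvalue_ne_zero hone (hAv i)
      (hk.trans_le (hA.eigenvalues₀_antitone (hle i hi))).ne'
  have hlone : v l ⬝ᵥ 1 ≠ 0 := fun h0 => by
    have := hsum 1 1
    rw [Finset.sum_eq_zero fun i _ => by
      by_cases hi : i = l
      · rw [hi, h0, zero_mul]
      · rw [hone' i hi, zero_mul]] at this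
    simp at this
    omega
  have hlx : v l ⬝ᵥ x = 0 := by
    have := hsum 1 x
    rw [Finset.sum_eq_single l (fun i _ hi => by rw [hone' i hi, zero_mul]) (by simp)] at this
    rw [dotProduct_comm, dotProduct_one, hx] at this
    exact (mul_eq_zero.mp this.symm).resolve_left hlone
  rw [hsum x x, hsum x (A *ᵥ x), Finset.mul_sum]
  refine Finset.sum_le_sum fun i _ => ?_
  rw [hA.dotProduct_mulVec_comm, hAv, smul_dotProduct, smul_eq_mul]
  by_cases hi : i = l
  · rw [hi, hlx]; simp
  · nlinarith [hA.eigenvalues₀_antitone (hle i hi), mul_self_nonneg (v i ⬝ᵥ x)]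

end Matrix.IsHermitian


/-! ### Sums over unordered pairs -/

open Equiv

theorem sum_pairs_eq_sum_ite {n : ℕ} (F : Fin n → Fin n → ℝ) :
    ∑ p : Fin n × Fin n with p.1 < p.2, F p.1 p.2 = ∑ i, ∑ j, if i < j then F i j else 0 := by
  rw [Finset.sum_filter, Fintype.sum_prod_type]

theorem sum_pairs_eq_half {n : ℕ} (F : Fin n → Fin n → ℝ) (hF : ∀ i j, F i j = F j i)
    (h0 : ∀ i, F i i = 0) :
    ∑ p : Fin n × Fin n with p.1 < p.2, F p.1 p.2 = (∑ i, ∑ j, F i j) / 2 := by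
  have key : ∑ i, ∑ j, F i j =
      (∑ i, ∑ j, if i < j then F i j else 0) + ∑ i, ∑ j, if j < i then F j i else 0 := by
    rw [← Finset.sum_add_distrib]
    refine Finset.sum_congr rfl fun i _ => ?_
    rw [← Finset.sum_add_distrib]
    refine Finset.sum_congr rfl fun j _ => ?_
    rcases lt_trichotomy i j with h | rfl | h
    · simp [h, h.not_gt]
    · simp [h0]
    · simp [h, h.not_gt, hF i j]
  rw [sum_pairs_eq_sum_ite, key, Finset.sum_comm (f := fun i j => if j < i then F j i else 0)]
  ring

theorem sum_pairs_succ {n : ℕ} (F : Fin (n + 1) → Fin (n + 1) → ℝ) :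
    ∑ p : Fin (n + 1) × Fin (n + 1) with p.1 < p.2, F p.1 p.2 =
      (∑ p : Fin n × Fin n with p.1 < p.2, F p.1.castSucc p.2.castSucc) +
        ∑ i : Fin n, F i.castSucc (Fin.last n) := by
  rw [sum_pairs_eq_sum_ite, sum_pairs_eq_sum_ite fun i j : Fin n => F i.castSucc j.castSucc]
  simp [Fin.sum_univ_castSucc, Fin.castSucc_lt_last, Finset.sum_add_distrib,
    Fin.not_lt.mpr (Fin.le_last _)]

/-! ### Dirichlet forms of both Laplacians and the one-particle marginals -/

namespace WeightedGraph

open Matrix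

variable {n : ℕ} (G : WeightedGraph n)

theorem rwLaplacian_mulVec (φ : Fin n → ℝ) (x : Fin n) :
    (G.rwLaplacian *ᵥ φ) x = ∑ k, G.weight x k * (φ x - φ k) := by
  have : ∀ k, G.rwLaplacian x k * φ k =
      (if x = k then (∑ l, G.weight x l) * φ x else 0) - G.weight x k * φ k := by
    intro k
    by_cases h : x = k
    · subst h; simp [rwLaplacian, G.loopless]
    · simp [rwLaplacian, h]
  simp only [mulVec, dotProduct, this, Finset.sum_sub_distrib, mul_sub, Finset.sum_mul]
  simp

theorem rwLaplacian_form (φ : Fin n → ℝ) :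
    φ ⬝ᵥ G.rwLaplacian *ᵥ φ = (∑ i, ∑ j, G.weight i j * (φ i - φ j) ^ 2) / 2 := by
  have h1 : φ ⬝ᵥ G.rwLaplacian *ᵥ φ = ∑ i, ∑ j, G.weight i j * (φ i - φ j) * φ i := by
    simp only [dotProduct, rwLaplacian_mulVec, Finset.mul_sum]
    exact Finset.sum_congr rfl fun i _ => Finset.sum_congr rfl fun j _ => by ring
  have h2 : φ ⬝ᵥ G.rwLaplacian *ᵥ φ = ∑ i, ∑ j, -(G.weight i j * (φ i - φ j) * φ j) := by
    rw [h1, Finset.sum_comm]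
    exact Finset.sum_congr rfl fun i _ => Finset.sum_congr rfl fun j _ => by
      rw [G.symm j i]; ring
  have h3 : ∑ i, ∑ j, G.weight i j * (φ i - φ j) ^ 2 =
      (∑ i, ∑ j, G.weight i j * (φ i - φ j) * φ i) +
        ∑ i, ∑ j, -(G.weight i j * (φ i - φ j) * φ j) := by
    simp only [← Finset.sum_add_distrib]
    exact Finset.sum_congr rfl fun i _ => Finset.sum_congr rfl fun j _ => by ring
  rw [h3, ← h1, ← h2]; ring

theorem rwLaplacian_form_nonneg (φ : Fin n → ℝ) : 0 ≤ φ ⬝ᵥ G.rwLaplacian *ᵥ φ := by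
  rw [rwLaplacian_form]
  exact div_nonneg (Finset.sum_nonneg fun i _ => Finset.sum_nonneg fun j _ =>
    mul_nonneg (G.nonneg i j) (sq_nonneg _)) zero_le_two

theorem rwLaplacian_mulVec_one : G.rwLaplacian *ᵥ 1 = 0 := by
  ext x; simp [rwLaplacian_mulVec]

theorem interchangeLaplacian_mulVec (f : Perm (Fin n) → ℝ) (σ : Perm (Fin n)) :
    (G.interchangeLaplacian *ᵥ f) σ =
      ∑ p : Fin n × Fin n with p.1 < p.2,
        G.weight p.1 p.2 * (f σ - f (swap p.1 p.2 * σ)) := by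
  have key : ∀ τ, G.interchangeLaplacian σ τ * f τ =
      (if σ = τ then (∑ p : Fin n × Fin n with p.1 < p.2, G.weight p.1 p.2) * f σ else 0) -
        ∑ p : Fin n × Fin n with p.1 < p.2,
          if τ = swap p.1 p.2 * σ then G.weight p.1 p.2 * f τ else 0 := by
    intro τ
    by_cases h : σ = τ
    · subst h
      rw [Finset.sum_eq_zero (s := Finset.univ.filter fun p : Fin n × Fin n => p.1 < p.2)
        (f := fun p => if σ = swap p.1 p.2 * σ then G.weight p.1 p.2 * f σ else 0)]
      · simp [interchangeLaplacian]
      · intro p hp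
        rw [Finset.mem_filter] at hp
        rw [if_neg]
        intro h
        exact hp.2.ne (swap_eq_one_iff.mp (mul_eq_right.mp h.symm))
    · simp only [interchangeLaplacian, Matrix.of_apply, if_neg h, neg_mul, Finset.sum_mul,
        zero_sub]
      rw [← Finset.filter_filter, Finset.sum_filter]
  simp only [mulVec, dotProduct, key, Finset.sum_sub_distrib, mul_sub]
  rw [Finset.sum_comm]
  simp [Finset.sum_mul]

/-- The Dirichlet form of the transposition of `i` and `j` acting on the left. -/
def swapEnergy (f : Perm (Fin n) → ℝ) (i j : Fin n) : ℝ :=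
  ∑ σ, (f σ - f (swap i j * σ)) ^ 2

theorem swapEnergy_nonneg (f : Perm (Fin n) → ℝ) (i j : Fin n) : 0 ≤ swapEnergy f i j :=
  Finset.sum_nonneg fun _ _ => sq_nonneg _

/-- Reindex by the involution `σ ↦ swap i j * σ` and add the two expressions. -/
theorem two_mul_sum_mul_sub_swap (f : Perm (Fin n) → ℝ) (i j : Fin n) :
    2 * ∑ σ, f σ * (f σ - f (swap i j * σ)) = swapEnergy f i j := by
  have h : ∑ σ, f σ * (f σ - f (swap i j * σ)) =
      ∑ σ, f (swap i j * σ) * (f (swap i j * σ) - f σ) := by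
    rw [← Equiv.sum_comp (Equiv.mulLeft (swap i j))]
    simp [← mul_assoc]
  rw [two_mul]
  nth_rewrite 2 [h]
  rw [swapEnergy, ← Finset.sum_add_distrib]
  exact Finset.sum_congr rfl fun σ _ => by ring

theorem interchangeLaplacian_form (f : Perm (Fin n) → ℝ) :
    f ⬝ᵥ G.interchangeLaplacian *ᵥ f =
      (∑ p : Fin n × Fin n with p.1 < p.2, G.weight p.1 p.2 * swapEnergy f p.1 p.2) / 2 := by
  simp only [dotProduct, interchangeLaplacian_mulVec, Finset.mul_sum]
  rw [Finset.sum_comm, Finset.sum_div]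
  refine Finset.sum_congr rfl fun p _ => ?_
  rw [← two_mul_sum_mul_sub_swap, Finset.mul_sum, Finset.mul_sum, Finset.sum_div]
  exact Finset.sum_congr rfl fun σ _ => by ring

theorem interchangeLaplacian_form_nonneg (f : Perm (Fin n) → ℝ) :
    0 ≤ f ⬝ᵥ G.interchangeLaplacian *ᵥ f := by
  rw [interchangeLaplacian_form]
  exact div_nonneg (Finset.sum_nonneg fun p _ =>
    mul_nonneg (G.nonneg _ _) (swapEnergy_nonneg _ _ _)) zero_le_two

theorem interchangeLaplacian_mulVec_one : G.interchangeLaplacian *ᵥ 1 = 0 := by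
  ext x; simp [interchangeLaplacian_mulVec]

/-- The random-walk Laplacian is the restriction of the interchange Laplacian to one particle. -/
theorem sum_pairs_swap_eq_rwLaplacian (φ : Fin n → ℝ) (x : Fin n) :
    ∑ p : Fin n × Fin n with p.1 < p.2, G.weight p.1 p.2 * (φ x - φ (swap p.1 p.2 x)) =
      (G.rwLaplacian *ᵥ φ) x := by
  rw [sum_pairs_eq_half (fun i j => G.weight i j * (φ x - φ (swap i j x)))
    (fun i j => by rw [G.symm i j, Equiv.swap_comm]) (fun i => by simp)]
  have key : ∀ i j, G.weight i j * (φ x - φ (swap i j x)) =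
      (if i = x then G.weight x j * (φ x - φ j) else 0) +
        if j = x then G.weight x i * (φ x - φ i) else 0 := by
    intro i j
    by_cases hi : i = x
    · subst hi
      by_cases hj : j = i
      · subst hj; simp
      · simp [hj]
    · by_cases hj : j = x
      · subst hj; simp [hi, G.symm i j]
      · simp [hi, hj, swap_apply_of_ne_of_ne (Ne.symm hi) (Ne.symm hj)]
  simp only [key, Finset.sum_add_distrib]
  rw [Finset.sum_comm]
  simp [rwLaplacian_mulVec]

/-- A function of the position of particle `a` is mapped to such a function. -/
theorem interchangeLaplacian_mulVec_lift (φ : Fin n → ℝ) (a : Fin n) (σ : Perm (Fin n)) :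
    (G.interchangeLaplacian *ᵥ fun τ => φ (τ a)) σ = (G.rwLaplacian *ᵥ φ) (σ a) := by
  rw [interchangeLaplacian_mulVec, ← sum_pairs_swap_eq_rwLaplacian]
  rfl

/-- The sum of `f` over the permutations that put particle `a` at `x`. -/
def particleSum (f : Perm (Fin n) → ℝ) (a x : Fin n) : ℝ :=
  ∑ σ : Perm (Fin n), if σ a = x then f σ else 0

theorem sum_particleSum (f : Perm (Fin n) → ℝ) (a : Fin n) :
    ∑ x, particleSum f a x = ∑ σ, f σ := by
  simp only [particleSum]
  rw [Finset.sum_comm]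
  simp

/-- The dual of the lift: left multiplication by a transposition moves particle `a` by that
transposition, whatever the other particles do. -/
theorem particleSum_interchangeLaplacian (f : Perm (Fin n) → ℝ) (a : Fin n) :
    particleSum (G.interchangeLaplacian *ᵥ f) a = G.rwLaplacian *ᵥ particleSum f a := by
  have hswap : ∀ (i j x : Fin n),
      ∑ σ : Perm (Fin n), (if σ a = x then f (swap i j * σ) else 0) =
        particleSum f a (swap i j x) := by
    intro i j x
    rw [particleSum, ← Equiv.sum_comp (Equiv.mulLeft (swap i j))]
    refine Finset.sum_congr rfl fun σ _ => ?_
    simp [← mul_assoc, Equiv.swap_apply_eq_iff]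
  ext x
  rw [← sum_pairs_swap_eq_rwLaplacian]
  simp only [← hswap]
  simp only [particleSum, interchangeLaplacian_mulVec, ← Finset.sum_sub_distrib, Finset.mul_sum]
  rw [Finset.sum_comm]
  refine Finset.sum_congr rfl fun σ _ => ?_
  split_ifs <;> simp

theorem rwSpectralGap_nonneg (h : 2 ≤ n) : 0 ≤ G.rwSpectralGap h :=
  G.rwLaplacian_isHermitian.eigenvalues₀_nonneg_of_form_nonneg G.rwLaplacian_form_nonneg _

theorem exists_rwSpectralGap_eigenvector (h : 2 ≤ n) :
    ∃ φ : Fin n → ℝ, φ ≠ 0 ∧ ∑ i, φ i = 0 ∧ G.rwLaplacian *ᵥ φ = G.rwSpectralGap h • φ :=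
  G.rwLaplacian_isHermitian.exists_secondSmallest_eigenvector _ G.rwLaplacian_form_nonneg
    G.rwLaplacian_mulVec_one

theorem rwSpectralGap_mul_le (h : 2 ≤ n) {φ : Fin n → ℝ} (hφ : ∑ i, φ i = 0) :
    G.rwSpectralGap h * (φ ⬝ᵥ φ) ≤ φ ⬝ᵥ G.rwLaplacian *ᵥ φ :=
  G.rwLaplacian_isHermitian.secondSmallestEigenvalue_mul_le _ G.rwLaplacian_form_nonneg
    G.rwLaplacian_mulVec_one hφ

theorem exists_interchangeSpectralGap_eigenvector (h : 2 ≤ n) :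
    ∃ f : Perm (Fin n) → ℝ, f ≠ 0 ∧ ∑ σ, f σ = 0 ∧
      G.interchangeLaplacian *ᵥ f = G.interchangeSpectralGap h • f :=
  G.interchangeLaplacian_isHermitian.exists_secondSmallest_eigenvector _
    G.interchangeLaplacian_form_nonneg G.interchangeLaplacian_mulVec_one

theorem interchangeSpectralGap_mul_le (h : 2 ≤ n) {f : Perm (Fin n) → ℝ} (hf : ∑ σ, f σ = 0) :
    G.interchangeSpectralGap h * (f ⬝ᵥ f) ≤ f ⬝ᵥ G.interchangeLaplacian *ᵥ f :=
  G.interchangeLaplacian_isHermitian.secondSmallestEigenvalue_mul_le _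
    G.interchangeLaplacian_form_nonneg G.interchangeLaplacian_mulVec_one hf

theorem dotProduct_self_pos {ι : Type*} [Fintype ι] {x : ι → ℝ} (hx : x ≠ 0) : 0 < x ⬝ᵥ x :=
  lt_of_le_of_ne (Finset.sum_nonneg fun _ _ => mul_self_nonneg _)
    fun h => hx (dotProduct_self_eq_zero.mp h.symm)

theorem interchangeSpectralGap_le_rwSpectralGap (h : 2 ≤ n) :
    G.interchangeSpectralGap h ≤ G.rwSpectralGap h := by
  obtain ⟨φ, hφ0, hφ1, hφ⟩ := G.exists_rwSpectralGap_eigenvector h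
  let a : Fin n := ⟨0, by omega⟩
  let f : Perm (Fin n) → ℝ := fun τ => φ (τ a)
  have hLf : G.interchangeLaplacian *ᵥ f = G.rwSpectralGap h • f := by
    ext σ
    rw [G.interchangeLaplacian_mulVec_lift φ a σ, hφ]
    rfl
  have hf0 : f ≠ 0 := fun h0 => hφ0 <| by
    ext x
    simpa [f] using congrFun h0 (swap a x)
  have hf1 : ∑ σ, f σ = 0 := by
    -- Right translation makes the sum independent of the particle; summing over all particles then
    -- yields copies of `∑ i, φ i = 0`.
    have hc : ∀ x : Fin n, ∑ σ, f σ = ∑ σ : Perm (Fin n), φ (σ x) := by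
      intro x
      rw [← Equiv.sum_comp (Equiv.mulRight (swap a x))]
      simp [f]
    have : ∑ x : Fin n, ∑ σ, f σ = 0 := by
      rw [Finset.sum_congr rfl fun x _ => hc x, Finset.sum_comm]
      exact Finset.sum_eq_zero fun σ _ => by rw [Equiv.sum_comp, hφ1]
    rw [Finset.sum_const, nsmul_eq_mul] at this
    refine (mul_eq_zero.mp this).resolve_left ?_
    simp; omega
  have := G.interchangeSpectralGap_mul_le h hf1
  rw [hLf, dotProduct_smul, smul_eq_mul] at this
  exact le_of_mul_le_mul_right this (dotProduct_self_pos hf0)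

end WeightedGraph


/-! ### Embedded symmetric groups and coset sums -/

namespace Equiv.Perm

theorem viaEmbeddingHom_swap {α β : Type*} [DecidableEq α] [DecidableEq β] (e : α ↪ β) (i j : α) :
    viaEmbeddingHom e (swap i j) = swap (e i) (e j) := by
  ext x
  rw [viaEmbeddingHom_apply]
  by_cases hx : x ∈ Set.range e
  · obtain ⟨y, rfl⟩ := hx
    rw [viaEmbedding_apply, e.injective.map_swap]
  · rw [viaEmbedding_apply_of_notMem _ _ _ hx, swap_apply_of_ne_of_ne]
    · rintro rfl; exact hx ⟨i, rfl⟩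
    · rintro rfl; exact hx ⟨j, rfl⟩

theorem exists_viaEmbeddingHom_castSucc_eq {n : ℕ} {π : Perm (Fin (n + 1))}
    (hπ : π (Fin.last n) = Fin.last n) :
    ∃ ρ : Perm (Fin n), viaEmbeddingHom Fin.castSuccEmb ρ = π := by
  have hne : ∀ i : Fin n, π i.castSucc ≠ Fin.last n := fun i h =>
    (Fin.castSucc_lt_last i).ne (π.injective (h.trans hπ.symm))
  have hinj : Function.Injective fun i : Fin n => (π i.castSucc).castPred (hne i) := by
    intro i j h
    exact Fin.castSucc_injective n (π.injective (Fin.castPred_inj.mp h))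
  refine ⟨Equiv.ofBijective _ (Finite.injective_iff_bijective.mp hinj), Equiv.ext fun x => ?_⟩
  rw [viaEmbeddingHom_apply]
  induction x using Fin.lastCases with
  | last =>
    rw [viaEmbedding_apply_of_notMem, hπ]
    rintro ⟨i, hi⟩
    exact (Fin.castSucc_lt_last i).ne hi
  | cast i =>
    refine (viaEmbedding_apply _ Fin.castSuccEmb i).trans ?_
    simp

end Equiv.Perm

namespace WeightedGraph

open Matrix Equiv.Perm

variable {n : ℕ}

theorem sum_sum_viaEmbeddingHom_mul {k N : ℕ} (e : Fin k ↪ Fin N) (F : Perm (Fin N) → ℝ) :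
    ∑ τ, ∑ ρ, F (viaEmbeddingHom e ρ * τ) = Fintype.card (Perm (Fin k)) * ∑ σ, F σ := by
  have h : ∀ ρ, ∑ τ, F (viaEmbeddingHom e ρ * τ) = ∑ σ, F σ := fun ρ =>
    Equiv.sum_comp (Equiv.mulLeft (viaEmbeddingHom e ρ)) F
  rw [Finset.sum_comm]
  simp [h]

theorem sum_swapEnergy_viaEmbeddingHom {k N : ℕ} (e : Fin k ↪ Fin N) (f : Perm (Fin N) → ℝ)
    (i j : Fin k) :
    ∑ τ, swapEnergy (fun ρ => f (viaEmbeddingHom e ρ * τ)) i j =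
      Fintype.card (Perm (Fin k)) * swapEnergy f (e i) (e j) := by
  simp only [swapEnergy, map_mul, viaEmbeddingHom_swap, mul_assoc]
  exact sum_sum_viaEmbeddingHom_mul e fun σ => (f σ - f (swap (e i) (e j) * σ)) ^ 2

theorem _root_.DirichletFormInequality.swapEnergy_le {m : ℕ} (h : DirichletFormInequality m)
    (g : Perm (Fin (m + 1)) → ℝ) (γ : Fin m → ℝ) (hγ : ∀ i, 0 ≤ γ i) :
    ∑ p : Fin m × Fin m with p.1 < p.2,
        γ p.1 * γ p.2 / (∑ l, γ l) * swapEnergy g p.1.castSucc p.2.castSucc ≤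
      ∑ i, γ i * swapEnergy g i.castSucc (Fin.last m) := by
  have := h g γ hγ
  rw [ge_iff_le, Finset.sum_comm, Finset.sum_comm (t := Finset.univ (α := Fin m))] at this
  simpa only [swapEnergy, Finset.mul_sum] using this

/-- Apply the inequality to `f` on every coset of the embedded group. Summing over all `τ`
multiplies each energy by the same factor, the order of that group. -/
theorem _root_.DirichletFormInequality.swapEnergy_le_embedding {m N : ℕ}
    (h : DirichletFormInequality m) (e : Fin (m + 1) ↪ Fin N) (f : Perm (Fin N) → ℝ)
    (γ : Fin m → ℝ) (hγ : ∀ i, 0 ≤ γ i) :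
    ∑ p : Fin m × Fin m with p.1 < p.2,
        γ p.1 * γ p.2 / (∑ l, γ l) * swapEnergy f (e p.1.castSucc) (e p.2.castSucc) ≤
      ∑ i, γ i * swapEnergy f (e i.castSucc) (e (Fin.last m)) := by
  have hc : (0 : ℝ) < Fintype.card (Perm (Fin (m + 1))) := by exact_mod_cast Fintype.card_pos
  have := Finset.sum_le_sum fun τ (_ : τ ∈ Finset.univ) =>
    h.swapEnergy_le (fun ρ => f (viaEmbeddingHom e ρ * τ)) γ hγ
  rw [Finset.sum_comm, Finset.sum_comm (t := Finset.univ (α := Fin m))] at this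
  simp only [← Finset.mul_sum, sum_swapEnergy_viaEmbeddingHom] at this
  simp only [mul_left_comm _ (Fintype.card (Perm (Fin (m + 1))) : ℝ), ← Finset.mul_sum] at this
  exact le_of_mul_le_mul_left this hc

/-- Covers an isolated last vertex, since the hypotheses on `C_k` start at `k = 2`. -/
theorem _root_.dirichletFormInequality_zero : DirichletFormInequality 0 := by
  intro g γ _
  simp

/-- The inequality of Dirichlet forms only involves the indices in the support of `γ`. -/
theorem swapEnergy_le_of_support (f : Perm (Fin (n + 1)) → ℝ) (γ : Fin n → ℝ)
    (hγ : ∀ i, 0 ≤ γ i)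
    (h : DirichletFormInequality (Finset.univ.filter fun i => 0 < γ i).card) :
    ∑ p : Fin n × Fin n with p.1 < p.2,
        γ p.1 * γ p.2 / (∑ l, γ l) * swapEnergy f p.1.castSucc p.2.castSucc ≤
      ∑ i, γ i * swapEnergy f i.castSucc (Fin.last n) := by
  set s := Finset.univ.filter fun i => 0 < γ i with hs
  -- Monotone, so that the condition `i < j` on pairs is preserved.
  let o : Fin s.card ↪o Fin n := s.orderEmbOfFin rfl
  have hzero : ∀ i, i ∉ Set.range o → γ i = 0 := by
    intro i hi
    rw [Finset.range_orderEmbOfFin, hs] at hi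
    exact le_antisymm (not_lt.mp (by simpa using hi)) (hγ i)
  have hsum : ∀ F : Fin n → ℝ, (∀ i, γ i = 0 → F i = 0) → ∑ i, F (o i) = ∑ i, F i :=
    fun F hF => Fintype.sum_of_injective o o.injective _ _ (fun i hi => hF i (hzero i hi))
      fun _ => rfl
  let e : Fin (s.card + 1) ↪ Fin (n + 1) :=
    ⟨Fin.lastCases (motive := fun _ => Fin (n + 1)) (Fin.last n) fun i => (o i).castSucc, by
      intro x y
      induction x using Fin.lastCases <;> induction y using Fin.lastCases <;>
        simp [Fin.castSucc_ne_last, (Fin.castSucc_ne_last _).symm]⟩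
  have hlast : e (Fin.last s.card) = Fin.last n :=
    Fin.lastCases_last (motive := fun _ => Fin (n + 1))
  have hcast : ∀ i : Fin s.card, e i.castSucc = (o i).castSucc := fun _ =>
    Fin.lastCases_castSucc (motive := fun _ => Fin (n + 1)) _
  have := h.swapEnergy_le_embedding e f (fun i => γ (o i)) fun i => hγ _
  simp only [hlast, hcast] at this
  rw [hsum γ fun _ => id, hsum (fun i => γ i * swapEnergy f i.castSucc (Fin.last n))
    fun i hi => by rw [hi, zero_mul]] at this
  refine le_of_eq_of_le ?_ this
  rw [sum_pairs_eq_sum_ite fun i j : Fin n =>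
      γ i * γ j / (∑ l, γ l) * swapEnergy f i.castSucc j.castSucc,
    sum_pairs_eq_sum_ite fun i j : Fin s.card =>
      γ (o i) * γ (o j) / (∑ l, γ l) * swapEnergy f (o i).castSucc (o j).castSucc,
    ← hsum _ fun i hi => by simp [hi]]
  refine Finset.sum_congr rfl fun i _ => ?_
  rw [← hsum _ fun j hj => by simp [hj]]
  simp only [o.lt_iff_lt]

variable (G : WeightedGraph (n + 1))

/-- The weights added by the reduction are the coefficients in the Dirichlet-form inequality for the
star at the last vertex, so the removed star edges pay for them. -/
theorem removeLast_energy_le (f : Perm (Fin (n + 1)) → ℝ)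
    (h : DirichletFormInequality
      (Finset.univ.filter fun i : Fin n => 0 < G.weight i.castSucc (Fin.last n)).card) :
    (∑ p : Fin n × Fin n with p.1 < p.2,
        G.removeLast.weight p.1 p.2 * swapEnergy f p.1.castSucc p.2.castSucc) / 2 ≤
      f ⬝ᵥ G.interchangeLaplacian *ᵥ f := by
  have key := swapEnergy_le_of_support f (fun i => G.weight i.castSucc (Fin.last n))
    (fun i => G.nonneg _ _) h
  rw [interchangeLaplacian_form, sum_pairs_succ fun i j => G.weight i j * swapEnergy f i j]
  have hsplit : ∑ p : Fin n × Fin n with p.1 < p.2,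
        G.removeLast.weight p.1 p.2 * swapEnergy f p.1.castSucc p.2.castSucc =
      (∑ p : Fin n × Fin n with p.1 < p.2,
        G.weight p.1.castSucc p.2.castSucc * swapEnergy f p.1.castSucc p.2.castSucc) +
      ∑ p : Fin n × Fin n with p.1 < p.2,
        G.weight p.1.castSucc (Fin.last n) * G.weight p.2.castSucc (Fin.last n) /
          (∑ l : Fin n, G.weight l.castSucc (Fin.last n)) *
            swapEnergy f p.1.castSucc p.2.castSucc := by
    rw [← Finset.sum_add_distrib]
    refine Finset.sum_congr rfl fun p hp => ?_
    rw [← add_mul]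
    simp [removeLast, (Finset.mem_filter.mp hp).2.ne]
  rw [hsplit]
  linarith

/-- The permutations `ι ρ * τ`, with `ρ` fixing the last position, are those that put particle
`τ⁻¹ (last n)` at the last position. -/
theorem sum_viaEmbeddingHom_castSucc_mul (f : Perm (Fin (n + 1)) → ℝ) (τ : Perm (Fin (n + 1))) :
    ∑ ρ, f (viaEmbeddingHom Fin.castSuccEmb ρ * τ) =
      particleSum f (τ⁻¹ (Fin.last n)) (Fin.last n) := by
  have hfix : ∀ ρ : Perm (Fin n),
      viaEmbeddingHom Fin.castSuccEmb ρ (Fin.last n) = Fin.last n := by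
    intro ρ
    rw [viaEmbeddingHom_apply, viaEmbedding_apply_of_notMem]
    rintro ⟨i, hi⟩
    exact (Fin.castSucc_lt_last i).ne hi
  rw [particleSum]
  refine Fintype.sum_of_injective (fun ρ => viaEmbeddingHom Fin.castSuccEmb ρ * τ)
    ((mul_left_injective τ).comp (viaEmbeddingHom_injective _)) _ _ (fun σ hσ => ?_) fun ρ => ?_
  · rw [if_neg]
    intro h
    obtain ⟨ρ, hρ⟩ := exists_viaEmbeddingHom_castSucc_eq (π := σ * τ⁻¹) h
    exact hσ ⟨ρ, by simp [hρ]⟩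
  · simp [hfix]

/-- The Poincaré inequality for the reduced graph, integrated over cosets. -/
theorem interchangeSpectralGap_mul_le_of_particleSum_eq_zero (H : WeightedGraph n) (hn : 2 ≤ n)
    {f : Perm (Fin (n + 1)) → ℝ} (hf : ∀ a x, particleSum f a x = 0) :
    H.interchangeSpectralGap hn * (f ⬝ᵥ f) ≤
      (∑ p : Fin n × Fin n with p.1 < p.2,
        H.weight p.1 p.2 * swapEnergy f p.1.castSucc p.2.castSucc) / 2 := by
  have hc : (0 : ℝ) < Fintype.card (Perm (Fin n)) := by exact_mod_cast Fintype.card_pos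
  have := Finset.sum_le_sum fun τ (_ : τ ∈ Finset.univ) =>
    H.interchangeSpectralGap_mul_le hn (f := fun ρ => f (viaEmbeddingHom Fin.castSuccEmb ρ * τ))
      -- The sum over each coset is a one-particle marginal, hence zero.
      (by rw [sum_viaEmbeddingHom_castSucc_mul, hf])
  simp only [interchangeLaplacian_form, ← Finset.mul_sum, ← Finset.sum_div] at this
  rw [Finset.sum_comm] at this
  simp only [← Finset.mul_sum, sum_swapEnergy_viaEmbeddingHom, dotProduct] at this
  rw [sum_sum_viaEmbeddingHom_mul Fin.castSuccEmb fun σ => f σ * f σ] at this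
  simp only [mul_left_comm _ (Fintype.card (Perm (Fin n)) : ℝ), ← Finset.mul_sum,
    mul_div_assoc] at this
  rw [mul_div_assoc'] at this
  have := le_of_mul_le_mul_left (by simpa only [mul_div_assoc] using this) hc
  simpa [dotProduct] using this

/-! ### Harmonic extension and random-walk interlacing -/

/-- Two expressions for a weighted variance: both equal `∑ γ φ² - (∑ γ φ)² / ∑ γ`, or zero if every
`γ i` vanishes. -/
theorem sum_mul_sub_weighted_mean_sq (γ φ : Fin n → ℝ) (hγ : ∀ i, 0 ≤ γ i) :
    ∑ i, γ i * (φ i - (∑ l, γ l * φ l) / ∑ l, γ l) ^ 2 =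
      (∑ i, ∑ j, γ i * γ j / (∑ l, γ l) * (φ i - φ j) ^ 2) / 2 := by
  rcases eq_or_ne (∑ l, γ l) 0 with h0 | h0
  · have hz : ∀ i, γ i = 0 := fun i =>
      (Finset.sum_eq_zero_iff_of_nonneg fun i _ => hγ i).mp h0 i (Finset.mem_univ i)
    simp [hz]
  have hL : ∑ i, γ i * (φ i - (∑ l, γ l * φ l) / ∑ l, γ l) ^ 2 =
      ∑ i, γ i * φ i ^ 2 - (∑ l, γ l * φ l) ^ 2 / ∑ l, γ l := by
    have : ∀ i, γ i * (φ i - (∑ l, γ l * φ l) / ∑ l, γ l) ^ 2 =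
        γ i * φ i ^ 2 - 2 * ((∑ l, γ l * φ l) / ∑ l, γ l) * (γ i * φ i) +
          ((∑ l, γ l * φ l) / ∑ l, γ l) ^ 2 * γ i := fun i => by ring
    simp only [this, Finset.sum_add_distrib, Finset.sum_sub_distrib, ← Finset.mul_sum]
    field_simp
    ring
  have hR : ∑ i, ∑ j, γ i * γ j / (∑ l, γ l) * (φ i - φ j) ^ 2 =
      2 * (∑ i, γ i * φ i ^ 2 - (∑ l, γ l * φ l) ^ 2 / ∑ l, γ l) := by
    have : ∀ i j, γ i * γ j / (∑ l, γ l) * (φ i - φ j) ^ 2 =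
        γ i * φ i ^ 2 / (∑ l, γ l) * γ j - 2 * (γ i * φ i) / (∑ l, γ l) * (γ j * φ j) +
          γ i / (∑ l, γ l) * (γ j * φ j ^ 2) := fun i j => by ring
    simp only [this, Finset.sum_add_distrib, Finset.sum_sub_distrib, ← Finset.mul_sum,
      ← Finset.sum_mul, ← Finset.sum_div]
    field_simp
    ring
  rw [hL, hR]
  ring

/-- Harmonic extension to the last vertex preserves the random-walk energy. -/
theorem rwLaplacian_form_harmonic_extension (φ : Fin n → ℝ) :
    (∑ i, ∑ j, G.weight i j * (Fin.snoc (α := fun _ => ℝ) φ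
        ((∑ l : Fin n, G.weight l.castSucc (Fin.last n) * φ l) /
          ∑ l : Fin n, G.weight l.castSucc (Fin.last n)) i -
      Fin.snoc (α := fun _ => ℝ) φ
        ((∑ l : Fin n, G.weight l.castSucc (Fin.last n) * φ l) /
          ∑ l : Fin n, G.weight l.castSucc (Fin.last n)) j) ^ 2) / 2 =
      φ ⬝ᵥ G.removeLast.rwLaplacian *ᵥ φ := by
  have key := sum_mul_sub_weighted_mean_sq (fun i => G.weight i.castSucc (Fin.last n)) φ
    fun i => G.nonneg _ _
  have hw : ∀ i j : Fin n, G.removeLast.weight i j * (φ i - φ j) ^ 2 =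
      G.weight i.castSucc j.castSucc * (φ i - φ j) ^ 2 +
        G.weight i.castSucc (Fin.last n) * G.weight j.castSucc (Fin.last n) /
          (∑ l : Fin n, G.weight l.castSucc (Fin.last n)) * (φ i - φ j) ^ 2 := by
    intro i j
    by_cases h : i = j
    · subst h; simp
    · simp [removeLast, h]; ring
  rw [rwLaplacian_form]
  simp only [hw, Finset.sum_add_distrib]
  simp only [Fin.sum_univ_castSucc, Fin.snoc_castSucc, Fin.snoc_last, Finset.sum_add_distrib,
    sub_self, G.symm (Fin.last n)]
  simp only [sub_sq_comm ((∑ l : Fin n, G.weight l.castSucc (Fin.last n) * φ l) /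
    ∑ l : Fin n, G.weight l.castSucc (Fin.last n))]
  rw [key]
  ring

/-- Interlacing for the random walk: removing the last vertex does not decrease the gap. -/
theorem rwSpectralGap_le_removeLast (hn : 2 ≤ n) :
    G.rwSpectralGap (hn.trans n.le_succ) ≤ G.removeLast.rwSpectralGap hn := by
  obtain ⟨φ, hφ0, hφ1, hφ⟩ := G.removeLast.exists_rwSpectralGap_eigenvector hn
  have hform := G.rwLaplacian_form_harmonic_extension φ
  set ψ : Fin (n + 1) → ℝ := Fin.snoc (α := fun _ => ℝ) φ
    ((∑ l : Fin n, G.weight l.castSucc (Fin.last n) * φ l) /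
      ∑ l : Fin n, G.weight l.castSucc (Fin.last n)) with hψ
  set c : ℝ := (∑ i, ψ i) / (n + 1 : ℕ) with hc
  have hmean : ∑ i, (ψ i - c) = 0 := by
    rw [Finset.sum_sub_distrib, Finset.sum_const, nsmul_eq_mul, Finset.card_univ,
      Fintype.card_fin, hc]
    field_simp
    ring
  have hgap := G.rwSpectralGap_mul_le (hn.trans n.le_succ) hmean
  rw [rwLaplacian_form] at hgap
  simp only [sub_sub_sub_cancel_right] at hgap
  rw [hform, hφ, dotProduct_smul, smul_eq_mul] at hgap
  -- Since `φ` has sum zero, shifting it by `c` adds `n c²` to its squared norm, and the extra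
  -- coordinate adds another square.
  have hnorm : φ ⬝ᵥ φ ≤ (fun i => ψ i - c) ⬝ᵥ fun i => ψ i - c := by
    have h1 : ∀ i, (φ i - c) * (φ i - c) = φ i * φ i - 2 * c * φ i + c * c := fun i => by ring
    simp only [dotProduct, Fin.sum_univ_castSucc, hψ, Fin.snoc_castSucc, Fin.snoc_last]
    simp only [h1, Finset.sum_add_distrib, Finset.sum_sub_distrib, ← Finset.mul_sum, hφ1,
      Finset.sum_const, nsmul_eq_mul]
    have h2 : (0 : ℝ) ≤ (Finset.univ (α := Fin n)).card * (c * c) :=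
      mul_nonneg (Nat.cast_nonneg _) (mul_self_nonneg _)
    have h3 := mul_self_nonneg ((∑ l : Fin n, G.weight l.castSucc (Fin.last n) * φ l) /
      (∑ l : Fin n, G.weight l.castSucc (Fin.last n)) - c)
    linarith
  exact le_of_mul_le_mul_right
    ((mul_le_mul_of_nonneg_left hnorm (G.rwSpectralGap_nonneg _)).trans hgap)
    (dotProduct_self_pos hφ0)

/-! ### The reduction step and the theorem -/

theorem aldousHolds_of_removeLast
    (h : DirichletFormInequality
      (Finset.univ.filter fun i : Fin n => 0 < G.weight i.castSucc (Fin.last n)).card)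
    (hG : G.removeLast.AldousHolds) : G.AldousHolds := by
  intro hn
  refine le_antisymm (G.interchangeSpectralGap_le_rwSpectralGap hn) ?_
  obtain ⟨f, hf0, hf1, hf⟩ := G.exists_interchangeSpectralGap_eigenvector hn
  by_cases hpart : ∀ a, particleSum f a = 0
  · by_cases hn' : 2 ≤ n
    · have h1 := interchangeSpectralGap_mul_le_of_particleSum_eq_zero G.removeLast hn'
        fun a x => congrFun (hpart a) x
      have h2 := h1.trans (G.removeLast_energy_le f h)
      rw [hf, dotProduct_smul, smul_eq_mul, hG hn'] at h2
      exact (G.rwSpectralGap_le_removeLast hn').trans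
        (le_of_mul_le_mul_right h2 (dotProduct_self_pos hf0))
    -- Here `n = 1`: each coset is a single permutation, so vanishing marginals force `f = 0`.
    · have : Subsingleton (Fin n) := Fin.subsingleton_iff_le_one.mpr (by omega)
      refine absurd (funext fun τ => ?_) hf0
      have := sum_viaEmbeddingHom_castSucc_mul f τ
      rwa [hpart, Fintype.sum_subsingleton _ 1, map_one, one_mul] at this
  · push Not at hpart
    obtain ⟨a, ha⟩ := hpart
    have heig := G.particleSum_interchangeLaplacian f a
    have hsmul : particleSum (G.interchangeSpectralGap hn • f) a =
        G.interchangeSpectralGap hn • particleSum f a := by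
      ext x
      simp [particleSum, Finset.mul_sum]
    rw [hf, hsmul] at heig
    have := G.rwSpectralGap_mul_le hn (φ := particleSum f a) (by rw [sum_particleSum, hf1])
    rw [← heig, dotProduct_smul, smul_eq_mul] at this
    exact le_of_mul_le_mul_right this (dotProduct_self_pos ha)

end WeightedGraph

theorem mainTheorem1 :
    (∀ (K n : ℕ) (G : WeightedGraph (n + 1)),
      (∀ m : ℕ, 2 ≤ m + 1 → m + 1 ≤ K → DirichletFormInequality m) →
      (Finset.univ.filter fun i : Fin n => 0 < G.weight i.castSucc (Fin.last n)).card + 1 ≤ K →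
      G.removeLast.AldousHolds → G.AldousHolds) ∧
    ((∀ m : ℕ, 2 ≤ m + 1 → DirichletFormInequality m) →
      ∀ (n : ℕ) (G : WeightedGraph n), G.AldousHolds) := by
  constructor
  · intro K n G hK hcard
    refine G.aldousHolds_of_removeLast ?_
    rcases Nat.eq_zero_or_pos
      (Finset.univ.filter fun i : Fin n => 0 < G.weight i.castSucc (Fin.last n)).card with h | h
    · rw [h]; exact dirichletFormInequality_zero
    · exact hK _ (by omega) hcard
  · intro hC n
    induction n with
    | zero => intro G h; omega
    | succ n ih =>
      intro G
      refine G.aldousHolds_of_removeLast ?_ (ih _)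
      rcases Nat.eq_zero_or_pos
        (Finset.univ.filter fun i : Fin n => 0 < G.weight i.castSucc (Fin.last n)).card with h | h
      · rw [h]; exact dirichletFormInequality_zero
      · exact hC _ (by omega)

end
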